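/- **Setting.** Let $\mathcal F$ be a signature (symbols with fixed arities), $\mathcal V$ a countably infinite set of variables. A TRS is a finite set of rules $l\to r$ with $l\notin\mathcal V$ and $\mathrm{Var}(r)\subseteq\mathrm{Var}(l)$. Let $\mathcal R$ and $\mathcal S$ be TRSs. The defined symbols $\mathcal D$ are the root symbols of the left-hand sides of $\mathcal R\cup\mathcal S$, the constructors are $\mathcal C=\mathcal F\setminus\mathcal D$, values are terms over $\mathcal C$ and $\mathcal V$, and basic terms are the terms $f(v_1,\dots,v_n)$ with $f\in\mathcal D$ and all $v_i$ values. $\mathcal R\cup\mathcal S$ is a constructor TRS if all its left-hand sides are basic. The size $|t|$ is the number of occurrences of symbols and variables in $t$. **Rewriting.** For TRSs $\mathcal P,\mathcal Q$, let $\to^{\mathcal Q}_{\mathcal P}$ be the rewrite relation of $\mathcal P$ restricted to steps in which all arguments of the redex are normal forms of $\mathcal Q$, and $\to^{\mathcal Q,\epsilon}_{\mathcal P}$ its further restriction to steps at the root. With $\mathcal Q=\mathcal R\cup\mathcal S$, the innermost relative root step is $$\to^{\epsilon}_{\mathcal R/\mathcal S}\;=\;(\to^{\mathcal Q}_{\mathcal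 S})^*\cdot\to^{\mathcal Q,\epsilon}_{\mathcal R}\cdot(\to^{\mathcal Q}_{\mathcal S})^*.$$ For a relation $\to$, $\mathrm{dl}(t,\to)=\max\{n\mid\exists u.\ t\to^n u\}$. **Orders.** A safe mapping assigns to each $n$-ary symbol $f$ a set $\mathrm{safe}(f)\subseteq\{1,\dots,n\}$ with $\mathrm{safe}(f)=\{1,\dots,n\}$ for $f\in\mathcal C$; $\mathrm{nrm}(f)$ is its complement; $\mathrm{safe}(s)$, $\mathrm{nrm}(s)$ denote the multisets of safe and normal arguments of a non-variable term $s$. A precedence is a preorder $\succsim$ on $\mathcal F$ with strict part $\succ$ and equivalence $\approx$; it is admissible if $f\succ g\in\mathcal D$ implies $f\in\mathcal D$, and $f\approx g$ implies $f\in\mathcal D\Leftrightarrow g\in\mathcal D$. Let $s\approx_s t$ if $s=t$, or $s=f(s_1,\dots,s_n)$, $t=g(t_1,\dots,t_n)$, $f\approx g$ and for some permutation $\tau$, $s_i\approx_s t_{\tau(i)}$ and ($i\in\mathrm{safe}(f)\Leftrightarrow\tau(i)\in\mathrm{safe}(g)$) for all $i$. The relations $\sqsupset$ and $>_{pop*}$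 are defined inductively, with $\sqsupseteq\,=\,\sqsupset\cup\approx_s$ and $\geqslant_{pop*}\,=\,>_{pop*}\cup\approx_s$. For $s=f(s_1,\dots,s_n)$: * $s\sqsupset t$ if (1) $s_i\sqsupseteq t$ for some $i$, where $i\in\mathrm{nrm}(f)$ if $f\in\mathcal D$; or (2) $t=g(t_1,\dots,t_m)$, $f\succ g$, $f\in\mathcal D$ and $s\sqsupset t_j$ for all $j$. * $s>_{pop*}t$ if $s\sqsupset t$; or (1) $s_i\geqslant_{pop*}t$ for some $i$; or (2) $t=g(t_1,\dots,t_m)$, $f\succ g$, $f\in\mathcal D$, and there is $j_0\in\mathrm{safe}(g)$ with $s>_{pop*}t_{j_0}$ such that for all $j\ne j_0$ either $s\sqsupset t_j$, or $j\in\mathrm{safe}(g)$ and $t_j$ is a proper subterm of $s$; or (3) $t=g(t_1,\dots,t_m)$, $f\approx g$, $\mathrm{nrm}(s)>^{mul}_{pop*}\mathrm{nrm}(t)$ and $\mathrm{safe}(s)\geqslant^{mul}_{pop*}\mathrm{safe}(t)$. Here $M\geqslant^{mul}_{pop*}N$ if $M=E\uplus X$ and $N=E'\uplus Y$, where $E$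 and $E'$ can be matched one-to-one along $\approx_s$ and every $y\in Y$ has some $x\in X$ with $x>_{pop*}y$; and $M>^{mul}_{pop*}N$ if moreover $X\neq\varnothing$. An argument filtering $\pi$ maps each $n$-ary $f$ to a position $i\in\{1,\dots,n\}$ or to an increasing list of positions. It induces a map on terms: $\pi(x)=x$; $\pi(f(t_1,\dots,t_n))=\pi(t_i)$ if $\pi(f)=i$; and $\pi(f(t_1,\dots,t_n))=f(\pi(t_{i_1}),\dots,\pi(t_{i_m}))$ if $\pi(f)=\{i_1<\dots<i_m\}$. The filtered signature consists of the symbols of the latter kind, with the precedence and $\mathcal D$ restricted to them and safe positions $\mathrm{safe}(f)\cap\pi(f)$. Put $s>^\pi_{pop*}t$ if $\pi(s)>_{pop*}\pi(t)$, and $s\geqslant^\pi_{pop*}t$ if $\pi(s)\geqslant_{pop*}\pi(t)$, over the filtered signature. **Theorem.** Let $\mathcal R\cup\mathcal S$ be a constructor TRS. There is a polynomial $p$, depending only on $\mathcal R\cup\mathcal S$ (with its signature), such that the following holds for every safe mapping, every admissible precedence and every argument filtering $\pi$: if $\mathcal R\subseteq{>^\pi_{pop*}}$ and $\mathcal S\subseteq{\geqslant^\pi_{pop*}}$,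 then for every ground basic term $t$ $$\mathrm{dl}(t,\to^{\epsilon}_{\mathcal R/\mathcal S})\leqslant p(|t|);$$ in particular, this derivation length is finite. -/

import Mathlib

universe u

namespace PolyPathOrder

/-- Terms over the signature with symbols `F` and arities `ar`; variables are natural numbers. -/
inductive Term {F : Type u} (ar : F → ℕ) : Type u
  | var (x : ℕ) : Term ar
  | app (f : F) (ts : Fin (ar f) → Term ar) : Term ar

section Terms

variable {F : Type u} {ar : F → ℕ}

/-- The set of variables of a term. -/
def Term.vars : Term ar → Set ℕ
  | .var x => {x}
  | .app _ ts => ⋃ i, (ts i).vars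

/-- The set of function symbols of a term. -/
def Term.funs : Term ar → Set F
  | .var _ => ∅
  | .app f ts => {f} ∪ ⋃ i, (ts i).funs

/-- The size of a term: the number of occurrences of variables and function symbols. -/
def Term.size : Term ar → ℕ
  | .var _ => 1
  | .app _ ts => 1 + ∑ i, (ts i).size

/-- Application of a substitution. -/
def Term.subst (σ : ℕ → Term ar) : Term ar → Term ar
  | .var x => σ x
  | .app f ts => .app f fun i => (ts i).subst σ

/-- Ground terms contain no variables. -/
def Term.IsGround (t : Term ar) : Prop := t.vars = ∅

/-- `ProperSubterm u s`: the term `u` is a proper subterm of `s`. -/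
inductive ProperSubterm : Term ar → Term ar → Prop
  | arg (f : F) (ss : Fin (ar f) → Term ar) (i : Fin (ar f)) :
      ProperSubterm (ss i) (.app f ss)
  | deep (f : F) (ss : Fin (ar f) → Term ar) (i : Fin (ar f)) (u : Term ar) :
      ProperSubterm u (ss i) → ProperSubterm u (.app f ss)

end Terms

/-! Term rewriting -/

/-- A rewrite rule `lhs → rhs`. -/
structure Rule {F : Type u} (ar : F → ℕ) where
  lhs : Term ar
  rhs : Term ar

section Rewriting

variable {F : Type u} {ar : F → ℕ}

/-- A term rewrite system is a finite set of rules whose left-hand sides are not variables and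
whose right-hand sides contain no variables that are absent from the left-hand side. -/
def IsTRS (R : Set (Rule ar)) : Prop :=
  R.Finite ∧ ∀ ρ ∈ R, (∀ x, ρ.lhs ≠ .var x) ∧ ρ.rhs.vars ⊆ ρ.lhs.vars

/-- The defined symbols: roots of left-hand sides. All other symbols are constructors. -/
def definedSymbols (R : Set (Rule ar)) : Set F :=
  {f | ∃ ρ ∈ R, ∃ ts, ρ.lhs = .app f ts}

/-- Values: terms over constructors and variables. -/
def IsValue (D : Set F) (t : Term ar) : Prop := ∀ f ∈ t.funs, f ∉ D

/-- Basic terms: a defined symbol applied to values. -/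
def IsBasic (D : Set F) (t : Term ar) : Prop :=
  ∃ f ts, t = .app f ts ∧ f ∈ D ∧ ∀ i, IsValue D (ts i)

/-- Constructor TRSs: all left-hand sides are basic. -/
def IsConstructorTRS (R : Set (Rule ar)) : Prop :=
  IsTRS R ∧ ∀ ρ ∈ R, IsBasic (definedSymbols R) ρ.lhs

/-- A rewrite step at the root. -/
def RootStep (R : Set (Rule ar)) (s t : Term ar) : Prop :=
  ∃ ρ ∈ R, ∃ σ : ℕ → Term ar, s = ρ.lhs.subst σ ∧ t = ρ.rhs.subst σ

/-- Closure of a relation under contexts. -/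
inductive CtxClosure (r : Term ar → Term ar → Prop) : Term ar → Term ar → Prop
  | root {s t : Term ar} : r s t → CtxClosure r s t
  | arg (f : F) (ss : Fin (ar f) → Term ar) (i : Fin (ar f)) {t : Term ar} :
      CtxClosure r (ss i) t → CtxClosure r (.app f ss) (.app f (Function.update ss i t))

/-- The rewrite relation of `R`. -/
def Rew (R : Set (Rule ar)) : Term ar → Term ar → Prop := CtxClosure (RootStep R)

/-- Normal forms of `Q`. -/
def IsNF (Q : Set (Rule ar)) (s : Term ar) : Prop := ¬ ∃ t, Rew Q s t

/-- A restricted root step: a root step of `R` in which all arguments of the redex are normal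
forms of `Q`. -/
def QRootStep (Q R : Set (Rule ar)) (s t : Term ar) : Prop :=
  RootStep R s t ∧ ∀ f ss, s = .app f ss → ∀ i, IsNF Q (ss i)

/-- The restricted rewrite relation: all arguments of the contracted redex are normal forms of
`Q`. -/
def QRew (Q R : Set (Rule ar)) : Term ar → Term ar → Prop := CtxClosure (QRootStep Q R)

/-- An innermost relative root step of `R` modulo `S`: restricted steps of `S` (anywhere), then
one restricted root step of `R`, then restricted steps of `S`; the restriction is always with
respect to `R ∪ S`. -/
def RelRootStep (R S : Set (Rule ar)) : Term ar → Term ar → Prop :=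
  Relation.Comp (Relation.ReflTransGen (QRew (R ∪ S) S))
    (Relation.Comp (QRootStep (R ∪ S) R) (Relation.ReflTransGen (QRew (R ∪ S) S)))

end Rewriting

/-- `Steps r n a b`: the `n`-fold application of `r` leads from `a` to `b`. -/
inductive Steps {α : Type u} (r : α → α → Prop) : ℕ → α → α → Prop
  | zero (a : α) : Steps r 0 a a
  | succ {n : ℕ} {a b c : α} : r a b → Steps r n b c → Steps r (n + 1) a c

/-- The derivation length of `a` with respect to `r`; it is `⊤` if there are arbitrarily long
derivations. -/
noncomputable def dl {α : Type u} (a : α) (r : α → α → Prop) : ℕ∞ :=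
  ⨆ n ∈ {n : ℕ | ∃ b, Steps r n a b}, (n : ℕ∞)

/-! Multiset extensions -/

section MultisetExtension

variable {α : Type u}

/-- The weak multiset extension of the preorder with strict part `gt` and equivalence `eqv`. -/
def MulGe (gt eqv : α → α → Prop) (M N : Multiset α) : Prop :=
  ∃ E E' X Y : Multiset α, M = E + X ∧ N = E' + Y ∧ Multiset.Rel eqv E E' ∧
    ∀ y ∈ Y, ∃ x ∈ X, gt x y

/-- The strict multiset extension of the preorder with strict part `gt` and equivalence `eqv`. -/
def MulGt (gt eqv : α → α → Prop) (M N : Multiset α) : Prop :=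
  ∃ E E' X Y : Multiset α, M = E + X ∧ N = E' + Y ∧ Multiset.Rel eqv E E' ∧ X ≠ 0 ∧
    ∀ y ∈ Y, ∃ x ∈ X, gt x y

end MultisetExtension

/-! Polynomial path orders -/

/-- Assigns to each symbol a set of safe argument positions; the other positions are normal. -/
abbrev SafeMap {F : Type u} (ar : F → ℕ) : Type u := (f : F) → Finset (Fin (ar f))

/-- Safe mappings: all argument positions of constructors are safe. -/
def IsSafeMapping {F : Type u} {ar : F → ℕ} (D : Set F) (safe : SafeMap ar) : Prop :=
  ∀ f, f ∉ D → safe f = Finset.univ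

section Precedence

variable {F : Type u} (ge : F → F → Prop)

/-- The strict part of a precedence. -/
def PrecGt (f g : F) : Prop := ge f g ∧ ¬ ge g f

/-- The equivalence induced by a precedence. -/
def PrecEqv (f g : F) : Prop := ge f g ∧ ge g f

/-- A precedence is a preorder on the symbols. -/
def IsPrecedence : Prop := (∀ f, ge f f) ∧ ∀ f g h, ge f g → ge g h → ge f h

/-- Admissible precedences, with `D` the set of defined symbols. -/
def IsAdmissible (D : Set F) : Prop :=
  (∀ f g, PrecGt ge f g → g ∈ D → f ∈ D) ∧ ∀ f g, PrecEqv ge f g → (f ∈ D ↔ g ∈ D)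

end Precedence

section Orders

variable {F : Type u} {ar : F → ℕ}

/-- The multiset of safe arguments of `f(ss)`. -/
def safeArgs (safe : SafeMap ar) (f : F) (ss : Fin (ar f) → Term ar) : Multiset (Term ar) :=
  (safe f).val.map ss

/-- The multiset of normal arguments of `f(ss)`. -/
def normalArgs (safe : SafeMap ar) (f : F) (ss : Fin (ar f) → Term ar) : Multiset (Term ar) :=
  ((safe f)ᶜ).val.map ss

variable (D : Set F) (safe : SafeMap ar) (ge : F → F → Prop)

/-- Equivalence of terms: arguments may be permuted and symbols replaced by equivalent ones, as
long as safe arguments correspond to safe arguments. -/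
inductive SafeEqv : Term ar → Term ar → Prop
  | refl (s : Term ar) : SafeEqv s s
  | app {f g : F} {ss : Fin (ar f) → Term ar} {ts : Fin (ar g) → Term ar}
      (e : Fin (ar f) ≃ Fin (ar g)) :
      PrecEqv ge f g → (∀ i, i ∈ safe f ↔ e i ∈ safe g) →
      (∀ i, SafeEqv (ss i) (ts (e i))) → SafeEqv (.app f ss) (.app g ts)

/-- The auxiliary order, in which recursive calls are impossible. -/
inductive GtSq : Term ar → Term ar → Prop
  | sub {f : F} {ss : Fin (ar f) → Term ar} {t : Term ar} (i : Fin (ar f)) :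
      (f ∈ D → i ∉ safe f) → GtSq (ss i) t → GtSq (.app f ss) t
  | subEqv {f : F} {ss : Fin (ar f) → Term ar} {t : Term ar} (i : Fin (ar f)) :
      (f ∈ D → i ∉ safe f) → SafeEqv safe ge (ss i) t → GtSq (.app f ss) t
  | comp {f g : F} {ss : Fin (ar f) → Term ar} {ts : Fin (ar g) → Term ar} :
      PrecGt ge f g → f ∈ D → (∀ j, GtSq (.app f ss) (ts j)) →
      GtSq (.app f ss) (.app g ts)

/-- The polynomial path order. In the last clause the arguments are compared by the multiset
extensions of the order itself: `gt` ranges over the subrelations of the order only to keep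
the clause positive, see `GtPop.mul'`. -/
inductive GtPop : Term ar → Term ar → Prop
  | sq {s t : Term ar} : GtSq D safe ge s t → GtPop s t
  | sub {f : F} {ss : Fin (ar f) → Term ar} {t : Term ar} (i : Fin (ar f)) :
      GtPop (ss i) t → GtPop (.app f ss) t
  | subEqv {f : F} {ss : Fin (ar f) → Term ar} {t : Term ar} (i : Fin (ar f)) :
      SafeEqv safe ge (ss i) t → GtPop (.app f ss) t
  | comp {f g : F} {ss : Fin (ar f) → Term ar} {ts : Fin (ar g) → Term ar}
      (j₀ : Fin (ar g)) :
      PrecGt ge f g → f ∈ D → j₀ ∈ safe g → GtPop (.app f ss) (ts j₀) →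
      (∀ j, j ≠ j₀ → GtSq D safe ge (.app f ss) (ts j) ∨
        (ProperSubterm (ts j) (.app f ss) ∧ j ∈ safe g)) →
      GtPop (.app f ss) (.app g ts)
  | mul {f g : F} {ss : Fin (ar f) → Term ar} {ts : Fin (ar g) → Term ar}
      (gt : Term ar → Term ar → Prop) :
      (∀ a b, gt a b → GtPop a b) → PrecEqv ge f g →
      MulGt gt (SafeEqv safe ge) (normalArgs safe f ss) (normalArgs safe g ts) →
      MulGe gt (SafeEqv safe ge) (safeArgs safe f ss) (safeArgs safe g ts) →
      GtPop (.app f ss) (.app g ts)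

/-- The last clause in its usual form; as the multiset extensions are monotone in `gt`, the two
forms are equivalent. -/
theorem GtPop.mul' {f g : F} {ss : Fin (ar f) → Term ar} {ts : Fin (ar g) → Term ar}
    (hfg : PrecEqv ge f g)
    (hn : MulGt (GtPop D safe ge) (SafeEqv safe ge) (normalArgs safe f ss) (normalArgs safe g ts))
    (hs : MulGe (GtPop D safe ge) (SafeEqv safe ge) (safeArgs safe f ss) (safeArgs safe g ts)) :
    GtPop D safe ge (.app f ss) (.app g ts) :=
  GtPop.mul _ (fun _ _ h => h) hfg hn hs

/-- The reflexive variant of the polynomial path order. -/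
def GePop (s t : Term ar) : Prop := GtPop D safe ge s t ∨ SafeEqv safe ge s t

end Orders

/-! Argument filterings -/

/-- An argument filtering maps each symbol either to one argument position (the symbol is
collapsed), or to an increasing list of argument positions, given here as a finite set. -/
abbrev ArgFilter {F : Type u} (ar : F → ℕ) : Type u :=
  (f : F) → Fin (ar f) ⊕ Finset (Fin (ar f))

section Filtering

variable {F : Type u} {ar : F → ℕ} (π : ArgFilter ar)

/-- The symbols of the filtered signature: those that are not collapsed. -/
abbrev FiltSym : Type u := {f : F // (π f).isRight = true}

/-- The argument positions kept by the filtering. -/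
def kept (f : FiltSym π) : Finset (Fin (ar f.1)) := (π f.1).getRight f.2

/-- Arities in the filtered signature. -/
def filtAr (f : FiltSym π) : ℕ := (kept π f).card

/-- The original position of an argument of a filtered symbol. -/
def origPos (f : FiltSym π) (j : Fin (filtAr π f)) : Fin (ar f.1) :=
  (kept π f).orderEmbOfFin rfl j

/-- The mapping on terms induced by an argument filtering. -/
def filt : Term ar → Term (filtAr π)
  | .var x => .var x
  | .app f ts =>
    match h : π f with
    | .inl i => filt (ts i)
    | .inr _ => .app ⟨f, by simp [h]⟩ fun j => filt (ts (origPos π ⟨f, by simp [h]⟩ j))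

/-- The safe mapping of the filtered signature. -/
def filtSafe (safe : SafeMap ar) : SafeMap (filtAr π) :=
  fun f => Finset.univ.filter fun j => origPos π f j ∈ safe f.1

variable (D : Set F) (safe : SafeMap ar) (ge : F → F → Prop)

/-- The strict order induced by a polynomial path order and an argument filtering. -/
def GtPopFilt (s t : Term ar) : Prop :=
  GtPop (ar := filtAr π) {f | f.1 ∈ D} (filtSafe π safe) (fun f g => ge f.1 g.1)
    (filt π s) (filt π t)

/-- The weak order induced by a polynomial path order and an argument filtering. -/
def GePopFilt (s t : Term ar) : Prop :=
  GePop (ar := filtAr π) {f | f.1 ∈ D} (filtSafe π safe) (fun f g => ge f.1 g.1)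
    (filt π s) (filt π t)

end Filtering

end PolyPathOrder

namespace PolyPathOrder

/-! Ranks of multisets of natural numbers -/

section MultisetRank

/-! Filtered terms are interpreted by natural numbers. A constructor adds one to the maximum of its
arguments, so values are measured by depth. A defined symbol `f` yields a function of its normal
arguments (`levelFun`) plus the maximum of its safe arguments.

Let `f(ss)` be a basic left-hand side, `W` the `K`-th iterate of the bound for symbols of lower
level at the largest normal argument, and `V` the largest safe argument. The value of `f(ss)` is
`(rank + 1) * (K * W + 1) + V`, where `rank` orders multisets of normal arguments as in the multiset
extension. A right-hand side has size at most `K`. Its parts below `f(ss)` in `GtSq` are at most `W`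
(`GtSq.interp_le`). A recursive call lowers the rank, hence costs at most `rank * (K * W + 1) + V`.
The symbols above it form a path through safe positions and add at most `W` each. So the right-hand
side stays below the left-hand side (`GtPop.interp_le`, `GtPop.interp_lt`).

The interpretation is weakly monotone (`interp_app_mono`), so steps of `S` anywhere do not increase
it, while root steps of `R` decrease it. It therefore bounds the derivation length. On basic terms
it is at most `levelBound` of the size, a polynomial determined by the maximal arity of defined
symbols, the maximal size of right-hand sides and the number of defined symbols. -/

theorem multiset_sup_mem {M : Multiset ℕ} (h : M ≠ 0) : M.sup ∈ M := by
  induction M using Multiset.induction with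
  | empty => exact absurd rfl h
  | cons a M ih =>
    rw [Multiset.sup_cons]
    by_cases hM : M = 0
    · simp [hM]
    · rcases le_total a M.sup with h' | h'
      · rw [sup_eq_right.2 h']
        exact Multiset.mem_cons_of_mem (ih hM)
      · rw [sup_eq_left.2 h']
        exact Multiset.mem_cons_self a M

/-- The number whose digits in base `b` are the successors of the `n` largest elements, in
descending order. -/
def mulRank (b : ℕ) : ℕ → Multiset ℕ → ℕ
  | 0, _ => 0
  | n + 1, M => if M = 0 then 0 else (M.sup + 1) * b ^ n + mulRank b n (M.erase M.sup)

theorem mulRank_lt_pow {b : ℕ} (hb : 0 < b) (n : ℕ) (M : Multiset ℕ)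
    (h : ∀ x ∈ M, x + 1 < b) : mulRank b n M < b ^ n := by
  induction n generalizing M with
  | zero => simp [mulRank]
  | succ n ih =>
    rw [mulRank]
    split_ifs with hM
    · positivity
    · have h1 := ih (M.erase M.sup) fun x hx => h x (Multiset.mem_of_mem_erase hx)
      have h2 : M.sup + 2 ≤ b := h _ (multiset_sup_mem hM)
      calc _ < (M.sup + 1) * b ^ n + b ^ n := by gcongr
        _ = (M.sup + 2) * b ^ n := by ring
        _ ≤ b * b ^ n := by gcongr
        _ = b ^ (n + 1) := by ring

/-- Needed because `levelFun` takes the base from the multiset itself, so two multisets are ranked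
in different bases. -/
theorem mulRank_mono_base {b b' : ℕ} (h : b ≤ b') (n : ℕ) (M : Multiset ℕ) :
    mulRank b n M ≤ mulRank b' n M := by
  induction n generalizing M with
  | zero => simp [mulRank]
  | succ n ih =>
    rw [mulRank, mulRank]
    split_ifs
    · exact le_rfl
    · gcongr
      exact ih _

theorem sup_add_le_of_dominated {E X Y : Multiset ℕ} (h : ∀ y ∈ Y, ∃ x ∈ X, y < x) :
    (E + Y).sup ≤ (E + X).sup := by
  refine Multiset.sup_le.2 fun y hy => ?_
  rcases Multiset.mem_add.1 hy with hy | hy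
  · exact Multiset.le_sup (Multiset.mem_add.2 (.inl hy))
  · obtain ⟨x, hx, hxy⟩ := h y hy
    exact hxy.le.trans (Multiset.le_sup (Multiset.mem_add.2 (.inr hx)))

/-- On a total order the multiset extension is the lexicographic comparison of the descending lists.
Digits are successors, so an element `0` still counts more than a missing one. -/
theorem mulRank_lt_mulRank {b : ℕ} (n : ℕ) {E X Y : Multiset ℕ} (hc : (E + X).card ≤ n)
    (hX : X ≠ 0) (h : ∀ y ∈ Y, ∃ x ∈ X, y < x) (hb : ∀ x ∈ E + X, x + 1 < b) :
    mulRank b n (E + Y) < mulRank b n (E + X) := by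
  induction n generalizing E with
  | zero =>
    have : E + X = 0 := Multiset.card_eq_zero.1 (by omega)
    exact absurd (by simpa using this : E = 0 ∧ X = 0).2 hX
  | succ n ih =>
    have hM : E + X ≠ 0 := fun h0 => hX (by simpa using h0 : E = 0 ∧ X = 0).2
    have hb0 : 0 < b := by have := hb _ (multiset_sup_mem hM); omega
    have hle := sup_add_le_of_dominated (E := E) h
    rw [mulRank, mulRank, if_neg hM]
    split_ifs with hN
    · positivity
    rcases hle.lt_or_eq with hlt | heq
    · have hbN : ∀ x ∈ (E + Y).erase (E + Y).sup, x + 1 < b := fun x hx => by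
        have h1 := Multiset.le_sup (Multiset.mem_of_mem_erase hx)
        have h2 := hb _ (multiset_sup_mem hM)
        omega
      calc _ < ((E + Y).sup + 1) * b ^ n + b ^ n := by
            gcongr
            exact mulRank_lt_pow hb0 n _ hbN
        _ = ((E + Y).sup + 1 + 1) * b ^ n := by ring
        _ ≤ ((E + X).sup + 1) * b ^ n := by gcongr; omega
        _ ≤ _ := Nat.le_add_right _ _
    · have hmem := multiset_sup_mem hN
      rw [heq] at hmem ⊢
      generalize hv : (E + X).sup = v at *
      -- A common maximum cannot come from `Y`, whose elements lie strictly below some element of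
      -- `X`. Hence it is in `E` and can be removed from both sides.
      have hvE : v ∈ E := by
        rcases Multiset.mem_add.1 hmem with hE | hY
        · exact hE
        · obtain ⟨x, hx, hxv⟩ := h v hY
          have : x ≤ (E + X).sup := Multiset.le_sup (Multiset.mem_add.2 (.inr hx))
          omega
      rw [Multiset.erase_add_left_pos _ hvE, Multiset.erase_add_left_pos _ hvE]
      gcongr
      apply ih
      · have h1 : (E.erase v).card + 1 = E.card := Multiset.card_erase_add_one hvE
        rw [Multiset.card_add] at hc ⊢
        omega
      · intro x hx
        refine hb x (Multiset.mem_add.2 ?_)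
        exact (Multiset.mem_add.1 hx).imp Multiset.mem_of_mem_erase id

end MultisetRank

/-! Bounding functions -/

section Bounds

variable (A K : ℕ)

/-- A bound on the interpretations of symbols of a level below `l`. -/
def levelBound : ℕ → ℕ → ℕ
  | 0, m => m + 1
  -- The second summand dominates `levelFun` at level `l`, with the rank replaced by `(m + 2) ^ A`;
  -- the first leaves room for a safe argument of value `m`.
  | l + 1, m => levelBound l m + ((m + 2) ^ A + 1) * (K * (levelBound l)^[K] m + 1)

/-- The interpretation of a defined symbol of level `l`, as a function of the interpretations of
its normal arguments. -/
def levelFun (l : ℕ) (M : Multiset ℕ) : ℕ :=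
  -- The base exceeds every digit `x + 1`. Each unit of rank pays for `K` symbols at the cost of the
  -- iterated bound, and one more for strictness.
  (mulRank (M.sup + 2) A M + 1) * (K * (levelBound A K l)^[K] M.sup + 1)

theorem levelBound_monotone (l : ℕ) : Monotone (levelBound A K l) := by
  induction l with
  | zero => exact fun a b h => Nat.add_le_add_right h 1
  | succ l ih =>
    intro a b h
    rw [levelBound, levelBound]
    have h1 := ih h
    have h2 := ih.iterate K h
    gcongr

theorem lt_levelBound (l m : ℕ) : m < levelBound A K l m := by
  induction l with
  | zero => exact Nat.lt_succ_self m
  | succ l ih => exact ih.trans_le (Nat.le_add_right _ _)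

theorem iterate_levelBound_mono (l : ℕ) {n n' : ℕ} (h : n ≤ n') (m : ℕ) :
    (levelBound A K l)^[n] m ≤ (levelBound A K l)^[n'] m :=
  Function.monotone_iterate_of_id_le (fun x => (lt_levelBound A K l x).le) h m

theorem le_iterate_levelBound (l n m : ℕ) : m ≤ (levelBound A K l)^[n] m :=
  iterate_levelBound_mono A K l (Nat.zero_le n) m

theorem levelBound_mono_level {l l' : ℕ} (h : l ≤ l') (m : ℕ) :
    levelBound A K l m ≤ levelBound A K l' m :=
  monotone_nat_of_le_succ (f := fun l => levelBound A K l m)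
    (fun _ => Nat.le_add_right _ _) h

theorem levelFun_add_lt_levelBound {l l' m : ℕ} (h : l < l') {M : Multiset ℕ}
    (hM : ∀ x ∈ M, x ≤ m) : levelFun A K l M + m < levelBound A K l' m := by
  have hs : M.sup ≤ m := Multiset.sup_le.2 hM
  have h1 : mulRank (M.sup + 2) A M ≤ (m + 2) ^ A :=
    (mulRank_lt_pow (by omega) A M fun x hx => by
      have := Multiset.le_sup hx; omega).le.trans (by gcongr)
  have h2 := (levelBound_monotone A K l).iterate K hs
  have h3 : levelFun A K l M ≤ ((m + 2) ^ A + 1) * (K * (levelBound A K l)^[K] m + 1) := by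
    rw [levelFun]; gcongr
  have h4 := levelBound_mono_level A K (Nat.succ_le_of_lt h) m
  have h5 := lt_levelBound A K l m
  rw [Nat.succ_eq_add_one, levelBound] at h4
  omega

/-- The weak multiset extension on natural numbers is respected by `levelFun`. -/
theorem levelFun_le {l : ℕ} {E X Y : Multiset ℕ} (hc : (E + X).card ≤ A)
    (h : ∀ y ∈ Y, ∃ x ∈ X, y < x) : levelFun A K l (E + Y) ≤ levelFun A K l (E + X) := by
  by_cases hX : X = 0
  · subst hX
    have : Y = 0 := Multiset.eq_zero_of_forall_notMem fun y hy => by simpa using h y hy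
    rw [this]
  · have hs := sup_add_le_of_dominated (E := E) h
    have h1 : mulRank ((E + Y).sup + 2) A (E + Y) ≤ mulRank ((E + X).sup + 2) A (E + X) :=
      (mulRank_mono_base (by omega) A _).trans
        (mulRank_lt_mulRank A hc hX h fun x hx => by have := Multiset.le_sup hx; omega).le
    have h2 := (levelBound_monotone A K l).iterate K hs
    rw [levelFun, levelFun]
    gcongr

/-- Strict multiset decrease leaves room for a multiple of the bound. -/
theorem levelFun_le_of_lt {l : ℕ} {E X Y : Multiset ℕ} (hc : (E + X).card ≤ A) (hX : X ≠ 0)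
    (h : ∀ y ∈ Y, ∃ x ∈ X, y < x) :
    levelFun A K l (E + Y) ≤ mulRank ((E + X).sup + 2) A (E + X) *
      (K * (levelBound A K l)^[K] (E + X).sup + 1) := by
  have hs := sup_add_le_of_dominated (E := E) h
  have h1 : mulRank ((E + Y).sup + 2) A (E + Y) < mulRank ((E + X).sup + 2) A (E + X) :=
    (mulRank_mono_base (by omega) A _).trans_lt
      (mulRank_lt_mulRank A hc hX h fun x hx => by have := Multiset.le_sup hx; omega)
  have h2 := (levelBound_monotone A K l).iterate K hs
  rw [levelFun]
  gcongr
  exact h1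

theorem exists_polynomial_iterate {f : ℕ → ℕ} (h : ∃ p : Polynomial ℕ, ∀ m, p.eval m = f m)
    (n : ℕ) : ∃ p : Polynomial ℕ, ∀ m, p.eval m = f^[n] m := by
  obtain ⟨p, hp⟩ := h
  induction n with
  | zero => exact ⟨.X, fun m => by simp⟩
  | succ n ih =>
    obtain ⟨q, hq⟩ := ih
    exact ⟨q.comp p, fun m => by rw [Polynomial.eval_comp, hp, hq, Function.iterate_succ_apply]⟩

theorem exists_polynomial_levelBound (l : ℕ) :
    ∃ p : Polynomial ℕ, ∀ m, p.eval m = levelBound A K l m := by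
  induction l with
  | zero => exact ⟨.X + 1, fun m => by simp [levelBound]⟩
  | succ l ih =>
    obtain ⟨q, hq⟩ := exists_polynomial_iterate ih K
    obtain ⟨p, hp⟩ := ih
    refine ⟨p + ((.X + 2) ^ A + 1) * (.C K * q + 1), fun m => ?_⟩
    simp [levelBound, hp, hq]

end Bounds

/-! Interpretation of terms -/

section Interpretation

variable {F : Type u} {ar : F → ℕ}

theorem isValue_app {D : Set F} {f : F} {ts : Fin (ar f) → Term ar} :
    IsValue D (.app f ts) ↔ f ∉ D ∧ ∀ i, IsValue D (ts i) := by
  simp only [IsValue, Term.funs, Set.mem_union, Set.mem_singleton_iff, Set.mem_iUnion]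
  constructor
  · exact fun h => ⟨h f (.inl rfl), fun i g hg => h g (.inr ⟨i, hg⟩)⟩
  · rintro ⟨h1, h2⟩ g (rfl | ⟨i, hg⟩)
    · exact h1
    · exact h2 i g hg

theorem size_arg_lt (f : F) (ts : Fin (ar f) → Term ar) (i : Fin (ar f)) :
    (ts i).size < (Term.app f ts).size := by
  have := Finset.single_le_sum (f := fun i => (ts i).size) (fun _ _ => Nat.zero_le _)
    (Finset.mem_univ i)
  simp only [Term.size]
  omega

theorem size_pos (t : Term ar) : 0 < t.size := by
  cases t <;> simp only [Term.size] <;> omega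

variable (D : Set F) (safe : SafeMap ar) (lev : F → ℕ) (A K : ℕ) (α : ℕ → ℕ)

open Classical in
/-- Interpretation of terms by natural numbers. Constructors measure the depth; defined symbols
depend polynomially on their normal arguments, and additively on the largest safe one. -/
noncomputable def interp : Term ar → ℕ
  | .var x => α x
  | .app f ts =>
    if f ∈ D then
      levelFun A K (lev f) ((safe f)ᶜ.val.map fun i => interp (ts i)) +
        (safe f).sup fun i => interp (ts i)
    else 1 + Finset.univ.sup fun i => interp (ts i)

local notation "P" => interp D safe lev A K α

variable {D safe lev A K α}

theorem interp_app_of_mem {f : F} (hf : f ∈ D) (ts : Fin (ar f) → Term ar) :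
    P (.app f ts) = levelFun A K (lev f) ((normalArgs safe f ts).map P) +
      (safe f).sup fun i => P (ts i) := by
  rw [interp, if_pos hf, normalArgs, Multiset.map_map]
  rfl

theorem interp_app_of_notMem {f : F} (hf : f ∉ D) (ts : Fin (ar f) → Term ar) :
    P (.app f ts) = 1 + Finset.univ.sup fun i => P (ts i) := by
  rw [interp, if_neg hf]

theorem interp_arg_lt {f : F} (hf : f ∉ D) (ts : Fin (ar f) → Term ar) (i : Fin (ar f)) :
    P (ts i) < P (.app f ts) := by
  rw [interp_app_of_notMem hf]
  have := Finset.le_sup (f := fun i => P (ts i)) (Finset.mem_univ i)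
  omega

/-- A substitution becomes a valuation, so rules need only be compared uninstantiated, for arbitrary
`α`. -/
theorem interp_subst (σ : ℕ → Term ar) (t : Term ar) :
    P (t.subst σ) = interp D safe lev A K (fun x => P (σ x)) t := by
  induction t with
  | var x => rfl
  | app f ts ih => simp only [Term.subst, interp, ih]

theorem card_normalArgs_le (hA : ∀ f ∈ D, ar f ≤ A) {f : F} (hf : f ∈ D)
    (ts : Fin (ar f) → Term ar) : (normalArgs safe f ts).card ≤ A := by
  rw [normalArgs, Multiset.card_map]
  exact (Finset.card_le_univ _).trans (by simpa using hA f hf)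

theorem interp_app_mono (hA : ∀ f ∈ D, ar f ≤ A) {f : F} {ss ts : Fin (ar f) → Term ar}
    (h : ∀ i, P (ts i) ≤ P (ss i)) : P (.app f ts) ≤ P (.app f ss) := by
  by_cases hf : f ∈ D
  · have hc := card_normalArgs_le (safe := safe) hA hf ss
    rw [interp_app_of_mem hf, interp_app_of_mem hf]
    refine Nat.add_le_add ?_ (Finset.sup_mono_fun fun i _ => h i)
    rw [← Multiset.card_map P] at hc
    simp only [normalArgs, Multiset.map_map, Function.comp_def] at hc ⊢
    classical
    -- Normal positions with unchanged value form the common part; at all others the value drops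
    -- strictly. This is an instance of the weak multiset extension.
    rw [← Multiset.filter_add_not (fun i => P (ts i) = P (ss i)) (safe f)ᶜ.val,
      Multiset.map_add] at hc ⊢
    rw [Multiset.map_add, Multiset.map_congr rfl (g := fun i => P (ss i))
      (s := Multiset.filter (fun i => P (ts i) = P (ss i)) _)
      fun i hi => (Multiset.mem_filter.1 hi).2]
    refine levelFun_le A K hc fun y hy => ?_
    obtain ⟨i, hi, rfl⟩ := Multiset.mem_map.1 hy
    exact ⟨_, Multiset.mem_map_of_mem _ hi,
      lt_of_le_of_ne (h i) (Multiset.mem_filter.1 hi).2⟩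
  · rw [interp_app_of_notMem hf, interp_app_of_notMem hf]
    exact Nat.add_le_add_left (Finset.sup_mono_fun fun i _ => h i) 1

theorem interp_value_le_size {t : Term ar} (ht : IsValue D t) :
    interp D safe lev A K (fun _ => 0) t ≤ t.size := by
  induction t with
  | var x => simp [interp]
  | app f ts ih =>
    obtain ⟨hf, hts⟩ := isValue_app.1 ht
    rw [interp_app_of_notMem hf, Term.size]
    refine Nat.add_le_add_left (Finset.sup_le fun i _ => (ih i (hts i)).trans ?_) 1
    exact Finset.single_le_sum (f := fun i => (ts i).size) (fun _ _ => Nat.zero_le _)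
      (Finset.mem_univ i)

/-! ### Compatibility of the interpretation with the orders -/

variable {ge : F → F → Prop}

theorem SafeEqv.interp_eq (hD : ∀ f g, PrecEqv ge f g → (f ∈ D ↔ g ∈ D))
    (hlev : ∀ f g, PrecEqv ge f g → lev f = lev g) {s t : Term ar} (h : SafeEqv safe ge s t) :
    P s = P t := by
  induction h with
  | refl s => rfl
  | @app f g ss ts e hfg he _ ih =>
    by_cases hf : f ∈ D
    · have hg := (hD f g hfg).1 hf
      have hS : safe g = (safe f).map e.toEmbedding := by
        ext j
        rw [Finset.mem_map_equiv, he, e.apply_symm_apply]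
      have hN : (safe g)ᶜ = (safe f)ᶜ.map e.toEmbedding := by
        ext j
        rw [Finset.mem_map_equiv, Finset.mem_compl, Finset.mem_compl, he, e.apply_symm_apply]
      rw [interp_app_of_mem hf, interp_app_of_mem hg, hlev f g hfg]
      simp only [normalArgs]
      rw [hN, hS, Finset.sup_map, Finset.map_val]
      simp only [Multiset.map_map, Function.comp_def, Equiv.coe_toEmbedding, ih]
    · have hg := mt (hD f g hfg).2 hf
      rw [interp_app_of_notMem hf, interp_app_of_notMem hg,
        ← Finset.map_univ_equiv e, Finset.sup_map]
      simp only [Function.comp_def, Equiv.coe_toEmbedding, ih]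

theorem ProperSubterm.interp_lt {u s : Term ar} (h : ProperSubterm u s) (hs : IsValue D s) :
    P u < P s := by
  induction h with
  | arg f ss i => exact interp_arg_lt (isValue_app.1 hs).1 ss i
  | deep f ss i u _ ih =>
    obtain ⟨hf, hss⟩ := isValue_app.1 hs
    exact (ih (hss i)).trans (interp_arg_lt hf ss i)

theorem GtSq.interp_lt (hD : ∀ f g, PrecEqv ge f g → (f ∈ D ↔ g ∈ D))
    (hlev : ∀ f g, PrecEqv ge f g → lev f = lev g) {s t : Term ar} (h : GtSq D safe ge s t)
    (hs : IsValue D s) : P t < P s := by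
  induction h with
  | sub i _ _ ih =>
    obtain ⟨hf, hss⟩ := isValue_app.1 hs
    exact (ih (hss i)).trans (interp_arg_lt hf _ i)
  | subEqv i _ h =>
    rw [← h.interp_eq hD hlev]
    exact interp_arg_lt (isValue_app.1 hs).1 _ i
  | comp _ hf => exact absurd hf (isValue_app.1 hs).1

theorem GtPop.interp_lt_of_isValue (hsafe : IsSafeMapping D safe)
    (hD : ∀ f g, PrecEqv ge f g → (f ∈ D ↔ g ∈ D))
    (hlev : ∀ f g, PrecEqv ge f g → lev f = lev g) {s t : Term ar} (h : GtPop D safe ge s t)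
    (hs : IsValue D s) : P t < P s := by
  induction h with
  | sq h => exact h.interp_lt hD hlev hs
  | sub i _ ih =>
    obtain ⟨hf, hss⟩ := isValue_app.1 hs
    exact (ih (hss i)).trans (interp_arg_lt hf _ i)
  | subEqv i h =>
    rw [← h.interp_eq hD hlev]
    exact interp_arg_lt (isValue_app.1 hs).1 _ i
  | comp _ _ hf => exact absurd hf (isValue_app.1 hs).1
  | @mul f g ss ts _ _ _ hn =>
    obtain ⟨E, E', X, Y, hM, -, -, hX, -⟩ := hn
    -- A constructor has no normal arguments, so the strict multiset comparison is impossible.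
    have : normalArgs safe f ss = 0 := by
      simp [normalArgs, hsafe f (isValue_app.1 hs).1]
    rw [this] at hM
    exact absurd (by simpa using hM.symm : E = 0 ∧ X = 0).2 hX

theorem interp_arg_le_max (f : F) (ss : Fin (ar f) → Term ar) (i : Fin (ar f)) :
    P (ss i) ≤ max ((normalArgs safe f ss).map P).sup ((safe f).sup fun i => P (ss i)) := by
  by_cases hi : i ∈ safe f
  · exact le_max_of_le_right (Finset.le_sup (f := fun i => P (ss i)) hi)
  · refine le_max_of_le_left (Multiset.le_sup (Multiset.mem_map_of_mem _ ?_))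
    exact Multiset.mem_map_of_mem _ (Finset.mem_compl.2 hi)

/-- Only normal arguments of `f(ss)` are accessible to `GtSq`, and each symbol placed above them
costs one application of the bound for levels below that of `f`. The size of `t` bounds the nesting.
-/
theorem GtSq.interp_le (hD : ∀ f g, PrecEqv ge f g → (f ∈ D ↔ g ∈ D))
    (hlev : ∀ f g, PrecEqv ge f g → lev f = lev g)
    (hlt : ∀ f g, PrecGt ge f g → g ∈ D → lev g < lev f)
    {s t : Term ar} (h : GtSq D safe ge s t) {f : F} {ss : Fin (ar f) → Term ar}
    (hs : s = .app f ss) (hf : f ∈ D) (hss : ∀ i, IsValue D (ss i)) :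
    P t ≤ (levelBound A K (lev f))^[t.size] ((normalArgs safe f ss).map P).sup := by
  have hnormal : ∀ i, i ∉ safe f → P (ss i) ≤ ((normalArgs safe f ss).map P).sup :=
    fun i hi => Multiset.le_sup (Multiset.mem_map_of_mem _
      (Multiset.mem_map_of_mem _ (Finset.mem_compl.2 hi)))
  induction h with
  | sub i hi h =>
    cases hs
    exact ((h.interp_lt hD hlev (hss i)).le.trans (hnormal i (hi hf))).trans
      (le_iterate_levelBound A K _ _ _)
  | subEqv i hi h =>
    cases hs
    rw [← h.interp_eq hD hlev]
    exact (hnormal i (hi hf)).trans (le_iterate_levelBound A K _ _ _)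
  | @comp f' g ss' ts hfg _ _ ih =>
    cases hs
    obtain ⟨n, hn⟩ : ∃ n, (Term.app g ts).size = n + 1 :=
      ⟨_, (Nat.succ_pred_eq_of_pos (size_pos _)).symm⟩
    have hle : ∀ j, P (ts j) ≤
        (levelBound A K (lev f))^[n] ((normalArgs safe f ss).map P).sup := fun j => by
      refine (ih j rfl).trans (iterate_levelBound_mono A K _ ?_ _)
      have := size_arg_lt g ts j
      omega
    rw [hn, Function.iterate_succ_apply']
    generalize (levelBound A K (lev f))^[n] ((normalArgs safe f ss).map P).sup = w at hle ⊢
    by_cases hg : g ∈ D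
    · rw [interp_app_of_mem hg]
      refine le_trans (Nat.add_le_add_left (Finset.sup_le fun j _ => hle j) _)
        (levelFun_add_lt_levelBound A K (hlt f g hfg hg) fun x hx => ?_).le
      simp only [normalArgs, Multiset.map_map, Multiset.mem_map] at hx
      obtain ⟨j, -, rfl⟩ := hx
      exact hle j
    · rw [interp_app_of_notMem hg]
      have h1 : (Finset.univ.sup fun j => P (ts j)) ≤ w := Finset.sup_le fun j _ => hle j
      have := lt_levelBound A K (lev f) w
      omega

theorem map_interp_eq_of_rel (hD : ∀ f g, PrecEqv ge f g → (f ∈ D ↔ g ∈ D))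
    (hlev : ∀ f g, PrecEqv ge f g → lev f = lev g) {E E' : Multiset (Term ar)}
    (h : Multiset.Rel (SafeEqv safe ge) E E') : E.map P = E'.map P := by
  induction h with
  | zero => rfl
  | cons h _ ih => rw [Multiset.map_cons, Multiset.map_cons, ih, h.interp_eq hD hlev]

/-- The three summands are the budget of one recursive call of smaller rank, one `W` for each symbol
of `t`, and the largest safe argument, which enters only additively. -/
theorem GtPop.interp_le (hsafe : IsSafeMapping D safe) (hA : ∀ f ∈ D, ar f ≤ A)
    (hD : ∀ f g, PrecEqv ge f g → (f ∈ D ↔ g ∈ D))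
    (hlev : ∀ f g, PrecEqv ge f g → lev f = lev g)
    (hlt : ∀ f g, PrecGt ge f g → g ∈ D → lev g < lev f)
    {s t : Term ar} (h : GtPop D safe ge s t) {f : F} {ss : Fin (ar f) → Term ar}
    (hs : s = .app f ss) (hf : f ∈ D) (hss : ∀ i, IsValue D (ss i)) (ht : t.size ≤ K)
    {M : Multiset ℕ} (hM : M = (normalArgs safe f ss).map P) :
    P t ≤ mulRank (M.sup + 2) A M * (K * (levelBound A K (lev f))^[K] M.sup + 1) +
      t.size * (levelBound A K (lev f))^[K] M.sup + (safe f).sup fun i => P (ss i) := by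
  have harg : ∀ i, P (ss i) ≤ M.sup + (safe f).sup fun i => P (ss i) := fun i =>
    (interp_arg_le_max f ss i).trans (by rw [← hM]; exact max_le (by omega) (by omega))
  have hsq : ∀ u : Term ar, u.size ≤ K → GtSq D safe ge (.app f ss) u →
      P u ≤ (levelBound A K (lev f))^[K] M.sup := fun u hu h => by
    rw [hM]
    exact (h.interp_le hD hlev hlt rfl hf hss).trans (iterate_levelBound_mono A K _ hu _)
  have hW := le_iterate_levelBound A K (lev f) K M.sup
  -- These quantities depend only on the left-hand side and stay fixed during the induction, where
  -- only `t.size` varies.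
  generalize hZ : mulRank (M.sup + 2) A M * (K * (levelBound A K (lev f))^[K] M.sup + 1) = Z
  generalize hWg : (levelBound A K (lev f))^[K] M.sup = W at hsq hW
  generalize hV : ((safe f).sup fun i => P (ss i)) = V at harg
  have hmul : ∀ u : Term ar, W ≤ u.size * W := fun u => Nat.le_mul_of_pos_left W (size_pos u)
  induction h with
  | @sq s t h =>
    subst hs
    have := hsq t ht h
    have := hmul t
    omega
  | @sub f' ss' t i h =>
    cases hs
    have := h.interp_lt_of_isValue (lev := lev) (A := A) (K := K) (α := α) hsafe hD hlev (hss i)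
    have := harg i
    have := hmul t
    omega
  | @subEqv f' ss' t i h =>
    cases hs
    have := h.interp_eq (lev := lev) (A := A) (K := K) (α := α) hD hlev
    have := harg i
    have := hmul t
    omega
  | @comp f' g ss' ts j₀ hfg _ hj₀ _ hj ih =>
    cases hs
    have hKlt : ∀ j, (ts j).size < K := fun j => (size_arg_lt g ts j).trans_le ht
    have hsup : (Finset.univ.sup fun j => P (ts j)) ≤ Z + (ts j₀).size * W + V ∧
        ((safe g).sup fun j => P (ts j)) ≤ Z + (ts j₀).size * W + V := by
      have : ∀ j, P (ts j) ≤ Z + (ts j₀).size * W + V := fun j => by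
        have h0 := hmul (ts j₀)
        by_cases hjj : j = j₀
        · subst hjj
          exact ih rfl (hKlt j).le
        rcases hj j hjj with h | ⟨h, -⟩
        · have := hsq _ (hKlt j).le h
          omega
        · generalize ts j = u at h
          cases h with
          | arg _ _ i => have := harg i; omega
          | deep _ _ i _ h =>
            have := h.interp_lt (safe := safe) (lev := lev) (A := A) (K := K) (α := α) (hss i)
            have := harg i
            omega
      exact ⟨Finset.sup_le fun j _ => this j, Finset.sup_le fun j _ => this j⟩
    have hsz : ((ts j₀).size + 1) * W ≤ (Term.app g ts).size * W :=
      Nat.mul_le_mul_right W (size_arg_lt g ts j₀)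
    rw [Nat.add_mul, one_mul] at hsz
    by_cases hg : g ∈ D
    · have hN : levelFun A K (lev g) ((normalArgs safe g ts).map P) ≤ W := by
        -- The arguments of `g` have size at most `K - 1`, so its normal ones are bounded by one
        -- iterate fewer; applying `g` uses the last iterate.
        obtain ⟨k, rfl⟩ : ∃ k, K = k + 1 := ⟨K - 1, by have := hKlt j₀; omega⟩
        rw [← hWg, Function.iterate_succ_apply']
        refine le_trans (Nat.le_add_right _ _)
          (levelFun_add_lt_levelBound A (k + 1) (hlt f g hfg hg) fun x hx => ?_).le
        simp only [normalArgs, Multiset.map_map, Multiset.mem_map] at hx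
        obtain ⟨j, hjn, rfl⟩ := hx
        have hjs : j ∉ safe g := Finset.mem_compl.1 hjn
        rcases hj j (fun h => hjs (h ▸ hj₀)) with h | ⟨-, h⟩
        · rw [hM]
          exact (h.interp_le hD hlev hlt rfl hf hss).trans
            (iterate_levelBound_mono A _ _ (Nat.lt_succ_iff.1 (hKlt j)) _)
        · exact absurd h hjs
      rw [interp_app_of_mem hg]
      have := hsup.2
      omega
    · rw [interp_app_of_notMem hg]
      have := hsup.1
      have : 1 ≤ W := by
        obtain ⟨k, rfl⟩ : ∃ k, K = k + 1 := ⟨K - 1, by have := hKlt j₀; omega⟩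
        rw [← hWg, Function.iterate_succ_apply']
        exact Nat.one_le_of_lt (lt_levelBound A _ _ _)
      omega
  | @mul f' g ss' ts gt hgt hfg hn hs' _ =>
    cases hs
    have hval : ∀ i b, gt (ss i) b → P b < P (ss i) := fun i b h =>
      (hgt _ _ h).interp_lt_of_isValue hsafe hD hlev (hss i)
    have hg := (hD f g hfg).1 hf
    -- Since arguments of `f(ss)` are values, the order on them is strict in the interpretation, and
    -- the rank drops.
    have h1 : levelFun A K (lev g) ((normalArgs safe g ts).map P) ≤ Z := by
      obtain ⟨E, E', X, Y, hME, hNE, hE, hX, hXY⟩ := hn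
      have hc := card_normalArgs_le (safe := safe) hA hf ss
      rw [← Multiset.card_map P, ← hM] at hc
      have hME' : M = E'.map P + X.map P := by
        rw [hM, hME, Multiset.map_add, map_interp_eq_of_rel hD hlev hE]
      rw [← hZ, ← hlev f g hfg, hNE, Multiset.map_add, hME']
      rw [hME'] at hc
      refine levelFun_le_of_lt A K hc (by simpa using hX) fun y hy => ?_
      obtain ⟨b, hb, rfl⟩ := Multiset.mem_map.1 hy
      obtain ⟨a, ha, hab⟩ := hXY b hb
      refine ⟨_, Multiset.mem_map_of_mem _ ha, ?_⟩
      have : a ∈ normalArgs safe f ss := hME ▸ Multiset.mem_add.2 (.inr ha)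
      obtain ⟨i, -, rfl⟩ := Multiset.mem_map.1 this
      exact hval i b hab
    have h2 : ((safe g).sup fun j => P (ts j)) ≤ V := by
      obtain ⟨E, E', X, Y, hME, hNE, hE, hXY⟩ := hs'
      have hV' : ∀ a ∈ safeArgs safe f ss, P a ≤ V := fun a ha => by
        obtain ⟨i, hi, rfl⟩ := Multiset.mem_map.1 ha
        rw [← hV]
        exact Finset.le_sup (f := fun i => P (ss i)) hi
      refine Finset.sup_le fun j hj => ?_
      have hmem : ts j ∈ safeArgs safe g ts := Multiset.mem_map_of_mem _ hj
      rw [hNE] at hmem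
      rcases Multiset.mem_add.1 hmem with hj | hj
      · have := Multiset.mem_map_of_mem P hj
        rw [← map_interp_eq_of_rel hD hlev hE] at this
        obtain ⟨a, ha, hab⟩ := Multiset.mem_map.1 this
        rw [← hab]
        exact hV' a (hME ▸ Multiset.mem_add.2 (.inl ha))
      · obtain ⟨a, ha, hab⟩ := hXY _ hj
        have ha' : a ∈ safeArgs safe f ss := hME ▸ Multiset.mem_add.2 (.inr ha)
        obtain ⟨i, -, rfl⟩ := Multiset.mem_map.1 ha'
        exact (hval i _ hab).le.trans (hV' _ ha')
    rw [interp_app_of_mem hg]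
    omega

/-- The order is strictly decreasing in the interpretation, if the larger term is a value or
basic and the smaller one is not too large. -/
theorem GtPop.interp_lt (hsafe : IsSafeMapping D safe) (hA : ∀ f ∈ D, ar f ≤ A)
    (hD : ∀ f g, PrecEqv ge f g → (f ∈ D ↔ g ∈ D))
    (hlev : ∀ f g, PrecEqv ge f g → lev f = lev g)
    (hlt : ∀ f g, PrecGt ge f g → g ∈ D → lev g < lev f)
    {s t : Term ar} (h : GtPop D safe ge s t) (hs : IsValue D s ∨ IsBasic D s)
    (ht : t.size ≤ K) : P t < P s := by
  rcases hs with hs | ⟨f, ss, rfl, hf, hss⟩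
  · exact h.interp_lt_of_isValue hsafe hD hlev hs
  · have h1 := h.interp_le (α := α) hsafe hA hD hlev hlt rfl hf hss ht rfl
    -- With `t.size ≤ K`, the final `+ 1` in `levelFun` makes the inequality strict.
    have h2 := Nat.mul_le_mul_right
      ((levelBound A K (lev f))^[K] ((normalArgs safe f ss).map P).sup) ht
    rw [interp_app_of_mem hf, levelFun, Nat.add_mul, one_mul]
    omega

theorem interp_le_of_isValue_or_isBasic {L : ℕ} (hL : ∀ f, lev f ≤ L) {t : Term ar}
    (ht : IsValue D t ∨ IsBasic D t) :
    interp D safe lev A K (fun _ => 0) t ≤ levelBound A K (L + 1) t.size := by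
  rcases ht with ht | ⟨f, ts, rfl, hf, hts⟩
  · exact (interp_value_le_size ht).trans (lt_levelBound A K _ _).le
  · have hle : ∀ i, interp D safe lev A K (fun _ => 0) (ts i) ≤ (Term.app f ts).size :=
      fun i => (interp_value_le_size (hts i)).trans (size_arg_lt f ts i).le
    rw [interp_app_of_mem hf]
    refine le_trans (Nat.add_le_add_left (Finset.sup_le fun i _ => hle i) _)
      (levelFun_add_lt_levelBound A K (Nat.lt_succ_of_le (hL f)) fun x hx => ?_).le
    simp only [normalArgs, Multiset.map_map, Multiset.mem_map] at hx
    obtain ⟨i, -, rfl⟩ := hx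
    exact hle i

end Interpretation

/-! Argument filterings -/

section FilteredTerms

variable {F : Type u} {ar : F → ℕ} {π : ArgFilter ar}

theorem filt_app_of_inl {f : F} {i : Fin (ar f)} (h : π f = .inl i)
    (ts : Fin (ar f) → Term ar) : filt π (.app f ts) = filt π (ts i) := by
  rw [filt]
  split
  · next j hj => rw [Sum.inl.inj (h.symm.trans hj)]
  · next hj => exact absurd (h.symm.trans hj) (by simp)

theorem filt_app_of_isRight {f : F} (h : (π f).isRight = true) (ts : Fin (ar f) → Term ar) :
    filt π (.app f ts) = .app (⟨f, h⟩ : FiltSym π) fun j => filt π (ts (origPos π ⟨f, h⟩ j)) := by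
  rw [filt]
  split
  · next hj => simp [hj] at h
  · rfl

theorem filt_subst (σ : ℕ → Term ar) (t : Term ar) :
    filt π (t.subst σ) = (filt π t).subst fun x => filt π (σ x) := by
  induction t with
  | var x => rfl
  | app f ts ih =>
    rw [Term.subst]
    by_cases h : (π f).isRight = true
    · rw [filt_app_of_isRight h, filt_app_of_isRight h, Term.subst]
      simp only [ih]
    · obtain ⟨i, hi⟩ : ∃ i, π f = .inl i := Sum.isLeft_iff.1 (by simpa using h)
      rw [filt_app_of_inl hi, filt_app_of_inl hi, ih]

theorem size_filt_le (t : Term ar) : (filt π t).size ≤ t.size := by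
  induction t with
  | var x => exact le_rfl
  | app f ts ih =>
    by_cases h : (π f).isRight = true
    · rw [filt_app_of_isRight h, Term.size, Term.size]
      refine Nat.add_le_add_left ((Finset.sum_le_sum fun j _ => ih _).trans ?_) 1
      have := Finset.sum_map Finset.univ ((kept π ⟨f, h⟩).orderEmbOfFin rfl).toEmbedding
        fun i => (ts i).size
      refine le_of_eq_of_le this.symm ?_
      exact Finset.sum_le_sum_of_subset (Finset.subset_univ _)
    · obtain ⟨i, hi⟩ : ∃ i, π f = .inl i := Sum.isLeft_iff.1 (by simpa using h)
      rw [filt_app_of_inl hi]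
      exact (ih i).trans (size_arg_lt f ts i).le

theorem IsValue.filt {D : Set F} {t : Term ar} (h : IsValue D t) :
    IsValue {f : FiltSym π | f.1 ∈ D} (filt π t) := by
  induction t with
  | var x => exact fun f hf => hf.elim
  | app f ts ih =>
    obtain ⟨hf, hts⟩ := isValue_app.1 h
    by_cases h : (π f).isRight = true
    · rw [filt_app_of_isRight h]
      exact isValue_app.2 ⟨hf, fun j => ih _ (hts _)⟩
    · obtain ⟨i, hi⟩ : ∃ i, π f = .inl i := Sum.isLeft_iff.1 (by simpa using h)
      rw [filt_app_of_inl hi]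
      exact ih i (hts i)

/-- If the root is collapsed, only one of its arguments remains, and this is a value. -/
theorem IsBasic.filt {D : Set F} {t : Term ar} (h : IsBasic D t) :
    IsValue {f : FiltSym π | f.1 ∈ D} (filt π t) ∨
      IsBasic {f : FiltSym π | f.1 ∈ D} (filt π t) := by
  obtain ⟨f, ts, rfl, hf, hts⟩ := h
  by_cases h : (π f).isRight = true
  · right
    exact ⟨_, _, filt_app_of_isRight h ts, hf, fun j => (hts _).filt⟩
  · left
    obtain ⟨i, hi⟩ : ∃ i, π f = .inl i := Sum.isLeft_iff.1 (by simpa using h)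
    rw [filt_app_of_inl hi]
    exact (hts i).filt

/-- Compatibility of the interpretation of filtered terms with root steps extends to contexts. -/
theorem CtxClosure.interp_filt_le {D' : Set (FiltSym π)} {safe' : SafeMap (filtAr π)}
    {lev : FiltSym π → ℕ} {A K : ℕ} {α : ℕ → ℕ} (hA : ∀ f ∈ D', filtAr π f ≤ A)
    {r : Term ar → Term ar → Prop}
    (hr : ∀ s t, r s t →
      interp D' safe' lev A K α (filt π t) ≤ interp D' safe' lev A K α (filt π s))
    {s t : Term ar} (h : CtxClosure r s t) :
    interp D' safe' lev A K α (filt π t) ≤ interp D' safe' lev A K α (filt π s) := by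
  induction h with
  | root h => exact hr _ _ h
  | @arg f ss i t _ ih =>
    have hup : ∀ j, interp D' safe' lev A K α (filt π (Function.update ss i t j)) ≤
        interp D' safe' lev A K α (filt π (ss j)) := fun j => by
      by_cases hj : j = i
      · subst hj
        rwa [Function.update_self]
      · rw [Function.update_of_ne hj]
    by_cases h : (π f).isRight = true
    · rw [filt_app_of_isRight h, filt_app_of_isRight h]
      exact interp_app_mono hA fun j => hup _
    · obtain ⟨j, hj⟩ : ∃ i, π f = .inl i := Sum.isLeft_iff.1 (by simpa using h)
      rw [filt_app_of_inl hj, filt_app_of_inl hj]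
      exact hup j

theorem finite_definedSymbols {T : Set (Rule ar)} (hT : T.Finite) :
    (definedSymbols T).Finite := by
  have : definedSymbols T = ⋃ ρ ∈ T, {f | ∃ ts, ρ.lhs = .app f ts} := by
    ext f
    simp [definedSymbols]
  rw [this]
  refine hT.biUnion fun ρ _ => Set.Subsingleton.finite ?_
  rintro f ⟨ts, h⟩ g ⟨us, h'⟩
  exact (Term.app.inj (h.symm.trans h')).1

theorem dl_le_of_measure {α : Type u} {r : α → α → Prop} (μ : α → ℕ)
    (h : ∀ a b, r a b → μ b < μ a) (a : α) : dl a r ≤ (μ a : ℕ∞) := by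
  have key : ∀ n a b, Steps r n a b → n ≤ μ a := fun n a b hs => by
    induction hs with
    | zero => exact Nat.zero_le _
    | succ hab _ ih => exact (Nat.succ_le_succ ih).trans (h _ _ hab)
  refine iSup₂_le fun n hn => ?_
  obtain ⟨b, hb⟩ := hn
  exact_mod_cast key n a b hb

end FilteredTerms

end PolyPathOrder

/-! ### The polynomial bound on derivation lengths -/

open PolyPathOrder in
theorem theoremt {F : Type u} (ar : F → ℕ) (T : Set (Rule ar)) (hT : IsConstructorTRS T) :
    ∃ p : Polynomial ℕ, ∀ R S : Set (Rule ar), R ∪ S = T →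
      ∀ (safe : SafeMap ar) (ge : F → F → Prop) (π : ArgFilter ar),
        IsSafeMapping (definedSymbols T) safe →
        IsPrecedence ge → IsAdmissible ge (definedSymbols T) →
        (∀ ρ ∈ R, GtPopFilt π (definedSymbols T) safe ge ρ.lhs ρ.rhs) →
        (∀ ρ ∈ S, GePopFilt π (definedSymbols T) safe ge ρ.lhs ρ.rhs) →
        ∀ t : Term ar, IsBasic (definedSymbols T) t → t.IsGround →
          dl t (RelRootStep R S) ≤ ((p.eval t.size : ℕ) : ℕ∞) := by
  classical
  obtain ⟨⟨hfin, -⟩, hbasic⟩ := hT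
  set D := definedSymbols T with hDdef
  have hDfin : D.Finite := finite_definedSymbols hfin
  let A := hDfin.toFinset.sup ar
  let K := hfin.toFinset.sup fun ρ => ρ.rhs.size
  let L := hDfin.toFinset.card
  obtain ⟨p, hp⟩ := exists_polynomial_levelBound A K (L + 1)
  refine ⟨p, fun R S hRS safe ge π hsafe hprec hadm hR hS t ht _ => ?_⟩
  -- Counting the defined symbols strictly below `f` bounds levels by `L` for every precedence,
  -- which keeps `p` uniform.
  let lev : FiltSym π → ℕ := fun f => (hDfin.toFinset.filter fun g => PrecGt ge f.1 g).card
  have hlevL : ∀ f, lev f ≤ L := fun f => Finset.card_filter_le _ _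
  have hlt : ∀ f g : FiltSym π, PrecGt (fun f g : FiltSym π => ge f.1 g.1) f g →
      g ∈ {f : FiltSym π | f.1 ∈ D} → lev g < lev f := by
    intro f g hfg hg
    refine Finset.card_lt_card (Finset.ssubset_iff_of_subset ?_ |>.2 ⟨g.1, ?_, ?_⟩)
    · intro h hh
      rw [Finset.mem_filter] at hh ⊢
      exact ⟨hh.1, hprec.2 _ _ _ hfg.1 hh.2.1, fun h' => hfg.2 (hprec.2 _ _ _ hh.2.1 h')⟩
    · exact Finset.mem_filter.2 ⟨hDfin.mem_toFinset.2 hg, hfg⟩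
    · exact fun h => (Finset.mem_filter.1 h).2.2 (hprec.1 _)
  have hlev : ∀ f g : FiltSym π, PrecEqv (fun f g : FiltSym π => ge f.1 g.1) f g →
      lev f = lev g := by
    intro f g hfg
    refine congrArg Finset.card (Finset.filter_congr fun h _ => ?_)
    exact ⟨fun h' => ⟨hprec.2 _ _ _ hfg.2 h'.1, fun h'' => h'.2 (hprec.2 _ _ _ h'' hfg.2)⟩,
      fun h' => ⟨hprec.2 _ _ _ hfg.1 h'.1, fun h'' => h'.2 (hprec.2 _ _ _ h'' hfg.1)⟩⟩
  have hD : ∀ f g : FiltSym π, PrecEqv (fun f g : FiltSym π => ge f.1 g.1) f g →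
      (f ∈ {f : FiltSym π | f.1 ∈ D} ↔ g ∈ {f : FiltSym π | f.1 ∈ D}) :=
    fun f g h => hadm.2 f.1 g.1 h
  have hsafe' : IsSafeMapping {f : FiltSym π | f.1 ∈ D} (filtSafe π safe) := fun f hf => by
    simp [filtSafe, hsafe f.1 hf]
  have hA : ∀ f ∈ {f : FiltSym π | f.1 ∈ D}, filtAr π f ≤ A := fun f hf =>
    ((Finset.card_le_univ _).trans (Fintype.card_fin _).le).trans
      (Finset.le_sup (f := ar) (hDfin.mem_toFinset.2 hf))
  have hK : ∀ ρ ∈ T, (filt π ρ.rhs).size ≤ K := fun ρ hρ =>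
    (size_filt_le _).trans
      (Finset.le_sup (f := fun ρ : Rule ar => ρ.rhs.size) (hfin.mem_toFinset.2 hρ))
  let μ : Term ar → ℕ := fun t =>
    interp {f : FiltSym π | f.1 ∈ D} (filtSafe π safe) lev A K (fun _ => 0) (filt π t)
  have hstepR : ∀ s t, QRootStep (R ∪ S) R s t → μ t < μ s := by
    rintro s t ⟨⟨ρ, hρ, σ, rfl, rfl⟩, -⟩
    have hρT : ρ ∈ T := hRS ▸ Or.inl hρ
    -- The instantiated rule is replaced by the filtered rule under a valuation; its left-hand side
    -- is a value or basic.
    simp only [μ, filt_subst, interp_subst]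
    exact (hR ρ hρ).interp_lt hsafe' hA hD hlev hlt (hbasic ρ hρT).filt (hK ρ hρT)
  have hstepS : ∀ s t, QRootStep (R ∪ S) S s t → μ t ≤ μ s := by
    rintro s t ⟨⟨ρ, hρ, σ, rfl, rfl⟩, -⟩
    have hρT : ρ ∈ T := hRS ▸ Or.inr hρ
    simp only [μ, filt_subst, interp_subst]
    rcases hS ρ hρ with h | h
    · exact (h.interp_lt hsafe' hA hD hlev hlt (hbasic ρ hρT).filt (hK ρ hρT)).le
    · exact (h.interp_eq hD hlev).ge
  have hS' : ∀ s t, Relation.ReflTransGen (QRew (R ∪ S) S) s t → μ t ≤ μ s := by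
    intro s t h
    induction h with
    | refl => exact le_rfl
    | tail _ h ih => exact (CtxClosure.interp_filt_le hA hstepS h).trans ih
  have hrel : ∀ s t, RelRootStep R S s t → μ t < μ s := by
    rintro s t ⟨u, hsu, v, huv, hvt⟩
    exact ((hS' _ _ hvt).trans_lt (hstepR _ _ huv)).trans_le (hS' _ _ hsu)
  refine (dl_le_of_measure μ hrel t).trans (Nat.cast_le.2 ?_)
  rw [hp]
  exact (interp_le_of_isValue_or_isBasic hlevL ht.filt).trans
    (levelBound_monotone A K _ (size_filt_le t))
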